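/- For a graph $G$ with vertex set $\{1,\dots,n\}$ and a real number $p\ge 1$, let \[ \lambda^{(p)}(G)=\max\Big\{2\sum_{\{i,j\}\in E(G)}x_ix_j:\ x_1,\dots,x_n\in\mathbb{R},\ |x_1|^p+\cdots+|x_n|^p=1\Big\} \] be its $p$-spectral radius, and let $T_r(n)$ be the $r$-partite Turán graph of order $n$, that is, the complete $r$-partite graph of order $n$ whose parts have size $\lfloor n/r\rfloor$ or $\lceil n/r\rceil$. Theorem 1. Let $r\ge 2$ be an integer and let $p>1$ be a real number. If $G$ is a $K_{r+1}$-free graph of order $n$, then $\lambda^{(p)}(G)<\lambda^{(p)}(T_r(n))$, unless $G$ is isomorphic to $T_r(n)$. -/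

import Mathlib

noncomputable section

namespace PSpectral

open Classical in
/-- The quadratic form `P_G(x) = 2 ∑_{{i,j} ∈ E(G)} x_i x_j` of a finite graph. -/
def quadForm {V : Type*} [Fintype V] (G : SimpleGraph V) (x : V → ℝ) : ℝ :=
  2 * ∑ e ∈ G.edgeFinset, (e.map x).mul

/-- The unit sphere `|x_1|^p + ⋯ + |x_n|^p = 1`. -/
def pSphere (V : Type*) [Fintype V] (p : ℝ) : Set (V → ℝ) :=
  {x | ∑ i, |x i| ^ p = 1}

/-- The `p`-spectral radius: the maximum of `P_G` over the unit sphere of the `ℓ^p` norm.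
For `1 ≤ p` and a nonempty vertex set the supremum is attained, see
`isGreatest_pSpectralRadius`. -/
def pSpectralRadius {V : Type*} [Fintype V] (p : ℝ) (G : SimpleGraph V) : ℝ :=
  sSup (quadForm G '' pSphere V p)

theorem isGreatest_pSpectralRadius {V : Type*} [Fintype V] [Nonempty V] {p : ℝ} (hp : 1 ≤ p)
    (G : SimpleGraph V) :
    IsGreatest (quadForm G '' pSphere V p) (pSpectralRadius p G) := by
  classical
  have hp0 : 0 < p := by linarith
  have hcont : Continuous (quadForm G) := by
    unfold quadForm
    refine continuous_const.mul (continuous_finsetSum _ fun e _ => ?_)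
    induction e using Sym2.ind with
    | _ a b =>
      simp only [Sym2.map_mk, Sym2.mul_mk]
      fun_prop
  have hclosed : IsClosed (pSphere V p) := by
    refine isClosed_eq (continuous_finsetSum _ fun i _ => ?_) continuous_const
    exact (continuous_apply i).abs.rpow_const fun _ => Or.inr hp0.le
  have hsub : pSphere V p ⊆ Set.Icc (fun _ => (-1 : ℝ)) (fun _ => 1) := by
    intro x hx
    have key : ∀ i, |x i| ≤ 1 := by
      intro i
      have h1 : |x i| ^ p ≤ 1 := by
        rw [← show ∑ i, |x i| ^ p = 1 from hx]
        exact Finset.single_le_sum (f := fun i => |x i| ^ p)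
          (fun j _ => Real.rpow_nonneg (abs_nonneg _) _) (Finset.mem_univ i)
      by_contra! h
      exact absurd h1 (not_le.2 (Real.one_lt_rpow h hp0))
    exact ⟨fun i => (abs_le.1 (key i)).1, fun i => (abs_le.1 (key i)).2⟩
  have hcomp : IsCompact (pSphere V p) := isCompact_Icc.of_isClosed_subset hclosed hsub
  have hne : (pSphere V p).Nonempty := by
    obtain ⟨v⟩ := ‹Nonempty V›
    refine ⟨Pi.single v 1, ?_⟩
    change ∑ i, |(Pi.single v 1 : V → ℝ) i| ^ p = 1
    rw [Finset.sum_eq_single v]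
    · simp
    · intro b _ hb
      simp [Pi.single_eq_of_ne hb, Real.zero_rpow hp0.ne']
    · simp
  exact (hcomp.image hcont).isGreatest_sSup (hne.image _)

end PSpectral

end

namespace PSpectral

open Finset

/-! The proof is Zykov symmetrization at a maximizing vector. Among the finitely many `K_{r+1}`-free
graphs on `V`, take one of largest radius, with a nonnegative maximizer `x`. Turning a vertex `t`
into a clone of a nonadjacent `s` creates no larger clique and changes the form by `2 x_t` times the
difference of weighted degrees (`quadForm_replaceVertex`). Since `p > 1`, cloning also excludes zero
entries (`apply_pos`), so nonadjacency is transitive (`not_adj_trans`) and the graph is complete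
multipartite. Part sizes differ by at most one, as otherwise moving a vertex and redistributing
weight would gain (`exists_balanced_values`, `card_part_le`). Too few parts would leave room for
another edge. Hence every maximizer is the Turán graph, which gives both the bound and uniqueness.
-/

theorem card_mul_avg_rpow_le {ι : Type*} {p : ℝ} (hp : 1 ≤ p) {A : Finset ι} (hA : A.Nonempty)
    {x : ι → ℝ} (hx : 0 ≤ x) : (#A : ℝ) * ((∑ u ∈ A, x u) / #A) ^ p ≤ ∑ u ∈ A, x u ^ p := by
  have ha : (0 : ℝ) < #A := by exact_mod_cast hA.card_pos
  have := Real.rpow_arith_mean_le_arith_mean_rpow A (fun _ => (#A : ℝ)⁻¹) x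
    (fun _ _ => by positivity) (by simp [ha.ne']) (fun u _ => hx u) hp
  rw [← mul_sum, ← mul_sum, ← div_eq_inv_mul, ← div_eq_inv_mul] at this
  rw [← le_div_iff₀' ha]
  exact this

/-! ### The quadratic form and its behaviour under cloning -/

variable {V : Type*} [Fintype V]

open Classical in
/-- The weighted degree `∑_{w ∼ v} x_w`. -/
noncomputable def nbrSum (G : SimpleGraph V) (x : V → ℝ) (v : V) : ℝ :=
  ∑ w, if G.Adj v w then x w else 0

theorem quadForm_eq_sum_mul_nbrSum (G : SimpleGraph V) (x : V → ℝ) :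
    quadForm G x = ∑ v, x v * nbrSum G x v := by
  classical
  have h1 : ∑ d : G.Dart, x d.fst * x d.snd = ∑ v, x v * nbrSum G x v := by
    rw [← sum_fiberwise (s := univ) (g := fun d : G.Dart => d.fst)]
    refine sum_congr rfl fun v _ => ?_
    have hfib : (univ.filter fun d : G.Dart => d.fst = v) = univ.image (G.dartOfNeighborSet v) := by
      convert G.dart_fst_fiber v
    rw [hfib, sum_image (fun a _ b _ h => G.dartOfNeighborSet_injective v h),
      nbrSum, mul_sum, ← sum_subset (subset_univ (G.neighborFinset v))]
    · rw [← sum_coe_sort (G.neighborFinset v)]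
      refine sum_equiv (Equiv.subtypeEquivRight (by simp)) (by simp) ?_
      rintro ⟨w, hw⟩ -
      have hw' : G.Adj v w := hw
      simp [SimpleGraph.dartOfNeighborSet, hw']
    · intro w _ hw
      have : ¬ G.Adj v w := by simpa using hw
      simp [this]
  -- Each edge carries exactly two darts, which accounts for the factor 2.
  rw [← h1, quadForm, mul_sum,
    ← sum_fiberwise_of_maps_to (s := univ) (t := G.edgeFinset) (g := fun d : G.Dart => d.edge)
      (fun d _ => by simp)]
  refine sum_congr (by ext; simp) fun e he => ?_
  rw [sum_congr rfl (g := fun _ => (e.map x).mul), sum_const,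
    G.dart_edge_fiber_card e (by simpa using he)]
  · simp
  · intro d hd
    rw [← (mem_filter.1 hd).2, SimpleGraph.Dart.edge]
    rfl

theorem nbrSum_nonneg {G : SimpleGraph V} {x : V → ℝ} (h : 0 ≤ x) (v : V) : 0 ≤ nbrSum G x v :=
  sum_nonneg fun w _ => by split_ifs; exacts [h w, le_rfl]

theorem le_nbrSum {G : SimpleGraph V} {x : V → ℝ} (h : 0 ≤ x) {v w : V} (hvw : G.Adj v w) :
    x w ≤ nbrSum G x v := by
  classical
  have := single_le_sum (f := fun w => if G.Adj v w then x w else 0)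
    (fun u _ => by split_ifs; exacts [h u, le_rfl]) (mem_univ w)
  simpa [hvw, nbrSum] using this

/-- There are no loops, so the form is affine in each coordinate, with slope twice the weighted
degree. -/
theorem quadForm_update [DecidableEq V] (G : SimpleGraph V) (x : V → ℝ) (v : V) (c : ℝ) :
    quadForm G (Function.update x v c) = quadForm G x + 2 * (c - x v) * nbrSum G x v := by
  classical
  have hN : ∀ u, nbrSum G (Function.update x v c) u =
      nbrSum G x u + if G.Adj u v then c - x v else 0 := by
    intro u
    have : (if G.Adj u v then c - x v else 0) =
        ∑ w, if w = v then (if G.Adj u v then c - x v else 0) else 0 := by simp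
    rw [nbrSum, nbrSum, this, ← sum_add_distrib]
    refine sum_congr rfl fun w _ => ?_
    rcases eq_or_ne w v with rfl | hw
    · simp only [Function.update_self, if_true]; split_ifs <;> ring
    · simp [hw]
  have h1 : ∑ u, Function.update x v c u * nbrSum G (Function.update x v c) u =
      ∑ u, (x u * nbrSum G x u + (x u * if G.Adj u v then c - x v else 0) +
        if u = v then (c - x v) * nbrSum G x v else 0) := by
    refine sum_congr rfl fun u _ => ?_
    rw [hN]
    rcases eq_or_ne u v with rfl | hu
    · simp; ring
    · simp [hu, mul_add]
  have h2 : ∑ u, (x u * if G.Adj u v then c - x v else 0) = (c - x v) * nbrSum G x v := by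
    rw [nbrSum, mul_sum]
    refine sum_congr rfl fun u _ => ?_
    simp only [G.adj_comm u v]
    split_ifs <;> ring
  rw [quadForm_eq_sum_mul_nbrSum, quadForm_eq_sum_mul_nbrSum, h1, sum_add_distrib,
    sum_add_distrib, h2]
  simp only [sum_ite_eq', mem_univ, if_true]
  ring

/-- If `x` vanishes at `v`, then `P_G(x)` does not see the edges at `v`. -/
theorem quadForm_congr_of_eq_zero {G H : SimpleGraph V} {x : V → ℝ} {v : V} (hv : x v = 0)
    (hGH : ∀ u w, u ≠ v → w ≠ v → (G.Adj u w ↔ H.Adj u w)) : quadForm G x = quadForm H x := by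
  classical
  rw [quadForm_eq_sum_mul_nbrSum, quadForm_eq_sum_mul_nbrSum]
  refine sum_congr rfl fun u _ => ?_
  rcases eq_or_ne u v with rfl | hu
  · simp [hv]
  congr 1
  refine sum_congr rfl fun w _ => ?_
  rcases eq_or_ne w v with rfl | hw
  · simp [hv]
  · simp [hGH u w hu hw]

theorem nbrSum_replaceVertex_right [DecidableEq V] {G : SimpleGraph V} (x : V → ℝ) {s t : V}
    (hst : ¬ G.Adj s t) : nbrSum (G.replaceVertex s t) x t = nbrSum G x s := by
  classical
  refine sum_congr rfl fun w _ => ?_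
  rcases eq_or_ne w t with rfl | hw
  · simp [hst]
  · simp [G.adj_replaceVertex_iff_of_ne_right s hw]

/-- With `x_t` set to zero the two graphs give the same form; restoring `x_t` brings in the weighted
degree of `t` in `G`, but that of `s` after cloning. -/
theorem quadForm_replaceVertex [DecidableEq V] {G : SimpleGraph V} (x : V → ℝ) {s t : V}
    (hst : ¬ G.Adj s t) : quadForm (G.replaceVertex s t) x =
      quadForm G x + 2 * x t * (nbrSum G x s - nbrSum G x t) := by
  have h1 := quadForm_update G x t 0
  have h2 := quadForm_update (G.replaceVertex s t) x t 0
  rw [nbrSum_replaceVertex_right x hst] at h2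
  have h3 := quadForm_congr_of_eq_zero (G := G) (H := G.replaceVertex s t)
    (x := Function.update x t 0) (v := t) (by simp)
    (fun u w hu hw => (G.adj_replaceVertex_iff_of_ne s hu hw).symm)
  linarith

theorem quadForm_nonneg (G : SimpleGraph V) {x : V → ℝ} (hx : 0 ≤ x) : 0 ≤ quadForm G x := by
  rw [quadForm_eq_sum_mul_nbrSum]
  exact sum_nonneg fun v _ => mul_nonneg (hx v) (nbrSum_nonneg hx v)

theorem quadForm_le_abs (G : SimpleGraph V) (x : V → ℝ) :
    quadForm G x ≤ quadForm G (fun v => |x v|) := by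
  rw [quadForm_eq_sum_mul_nbrSum, quadForm_eq_sum_mul_nbrSum]
  refine sum_le_sum fun v _ => ?_
  refine (le_abs_self _).trans ?_
  rw [abs_mul]
  refine mul_le_mul_of_nonneg_left ?_ (abs_nonneg _)
  refine (abs_sum_le_sum_abs _ _).trans (sum_le_sum fun w _ => ?_)
  split_ifs <;> simp

theorem quadForm_smul (G : SimpleGraph V) (c : ℝ) (x : V → ℝ) :
    quadForm G (fun v => c * x v) = c ^ 2 * quadForm G x := by
  classical
  have hN : ∀ v, nbrSum G (fun v => c * x v) v = c * nbrSum G x v := fun v => by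
    rw [nbrSum, nbrSum, mul_sum]
    exact sum_congr rfl fun w _ => by split_ifs <;> simp
  rw [quadForm_eq_sum_mul_nbrSum, quadForm_eq_sum_mul_nbrSum, mul_sum]
  exact sum_congr rfl fun v _ => by rw [hN]; ring

theorem quadForm_lt_of_lt {G H : SimpleGraph V} {x : V → ℝ} (hx : ∀ v, 0 < x v) (h : G < H) :
    quadForm G x < quadForm H x := by
  classical
  obtain ⟨hle, u, w, hH, hG⟩ : G ≤ H ∧ ∃ u w, H.Adj u w ∧ ¬ G.Adj u w := by
    refine ⟨h.le, ?_⟩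
    by_contra! hc
    exact h.not_ge fun u w => hc u w
  have hterm : ∀ v q, (if G.Adj v q then x q else 0) ≤ if H.Adj v q then x q else 0 := by
    intro v q
    by_cases h1 : G.Adj v q
    · simp [h1, hle h1]
    · simp only [h1, if_false]; split_ifs
      exacts [(hx q).le, le_rfl]
  rw [quadForm_eq_sum_mul_nbrSum, quadForm_eq_sum_mul_nbrSum]
  refine sum_lt_sum (fun v _ => mul_le_mul_of_nonneg_left (sum_le_sum fun q _ => hterm v q)
    (hx v).le) ⟨u, mem_univ _, mul_lt_mul_of_pos_left ?_ (hx u)⟩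
  exact sum_lt_sum (fun q _ => hterm u q) ⟨w, mem_univ _, by simp [hG, hH, hx w]⟩

theorem exists_adj_of_quadForm_pos {G : SimpleGraph V} {x : V → ℝ} (hx : 0 ≤ x)
    (h : 0 < quadForm G x) : ∃ u w, G.Adj u w ∧ 0 < x u ∧ 0 < x w := by
  classical
  by_contra! hc
  refine h.not_ge ?_
  rw [quadForm_eq_sum_mul_nbrSum]
  refine sum_nonpos fun u _ => ?_
  rcases (hx u).eq_or_lt with hu | hu
  · simp [← hu]
  · refine mul_nonpos_of_nonneg_of_nonpos hu.le (sum_nonpos fun w _ => ?_)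
    split_ifs with ha
    exacts [hc u w ha hu, le_rfl]

theorem quadForm_comp_iso {W : Type*} [Fintype W] {G : SimpleGraph V} {H : SimpleGraph W}
    (e : G ≃g H) (x : W → ℝ) : quadForm G (x ∘ e) = quadForm H x := by
  classical
  rw [quadForm_eq_sum_mul_nbrSum, quadForm_eq_sum_mul_nbrSum]
  refine Fintype.sum_equiv e.toEquiv _ _ fun v => ?_
  have : nbrSum G (x ∘ e) v = nbrSum H x (e v) :=
    Fintype.sum_equiv e.toEquiv _ _ fun w => by simp [e.map_adj_iff]
  rw [this]; rfl

theorem pSpectralRadius_eq_of_iso {W : Type*} [Fintype W] {G : SimpleGraph V} {H : SimpleGraph W}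
    (p : ℝ) (e : G ≃g H) : pSpectralRadius p G = pSpectralRadius p H := by
  have hGH : quadForm G '' pSphere V p ⊆ quadForm H '' pSphere W p := by
    rintro _ ⟨x, hx, rfl⟩
    refine ⟨x ∘ e.symm, ?_, quadForm_comp_iso e.symm x⟩
    refine Eq.trans ?_ (show ∑ i, |x i| ^ p = 1 from hx)
    exact Fintype.sum_equiv e.symm.toEquiv _ _ fun v => rfl
  have hHG : quadForm H '' pSphere W p ⊆ quadForm G '' pSphere V p := by
    rintro _ ⟨x, hx, rfl⟩
    refine ⟨x ∘ e, ?_, quadForm_comp_iso e x⟩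
    refine Eq.trans ?_ (show ∑ i, |x i| ^ p = 1 from hx)
    exact Fintype.sum_equiv e.toEquiv _ _ fun v => rfl
  rw [pSpectralRadius, pSpectralRadius, hGH.antisymm hHG]

/-- The quadratic form of a graph in which `A` and `B` are two parts, each of them an independent
set joined completely to the rest of the graph. -/
theorem quadForm_eq_of_parts [DecidableEq V] {G : SimpleGraph V} (x : V → ℝ) {A B : Finset V}
    (hAB : Disjoint A B) (hA : ∀ u ∈ A, ∀ w, G.Adj u w ↔ w ∉ A)
    (hB : ∀ u ∈ B, ∀ w, G.Adj u w ↔ w ∉ B) :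
    quadForm G x = 2 * ((∑ u ∈ A, x u) * ∑ u ∈ B, x u) +
      2 * ((∑ u ∈ A, x u + ∑ u ∈ B, x u) * ∑ u ∈ (A ∪ B)ᶜ, x u) +
      quadForm G (fun u => if u ∈ A ∪ B then 0 else x u) := by
  classical
  set x₀ : V → ℝ := fun u => if u ∈ A ∪ B then 0 else x u with hx₀
  have hsplit : ∀ f : V → ℝ, ∑ u, f u = ∑ u ∈ A, f u + ∑ u ∈ B, f u + ∑ u ∈ (A ∪ B)ᶜ, f u :=
    fun f => by rw [← sum_union hAB, sum_add_sum_compl]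
  have notB : ∀ u ∈ A, u ∉ B := fun u hu => disjoint_left.1 hAB hu
  have memC : ∀ w ∈ (A ∪ B)ᶜ, w ∉ A ∧ w ∉ B := fun w hw => by simpa using hw
  have x₀A : ∀ u ∈ A, x₀ u = 0 := fun u hu => by simp [hx₀, hu]
  have x₀B : ∀ u ∈ B, x₀ u = 0 := fun u hu => by simp [hx₀, hu]
  have x₀C : ∀ u ∈ (A ∪ B)ᶜ, x₀ u = x u := fun u hu => if_neg (mem_compl.1 hu)
  have sum_of_adj : ∀ (D : Finset V) (u : V), (∀ w ∈ D, G.Adj u w) →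
      ∑ w ∈ D, (if G.Adj u w then x w else 0) = ∑ w ∈ D, x w :=
    fun D u h => sum_congr rfl fun w hw => by simp [h w hw]
  have sum_of_not_adj : ∀ (D : Finset V) (u : V), (∀ w ∈ D, ¬ G.Adj u w) →
      ∑ w ∈ D, (if G.Adj u w then x w else 0) = 0 :=
    fun D u h => sum_eq_zero fun w hw => by simp [h w hw]
  have hNA : ∀ u ∈ A, x u * nbrSum G x u =
      x u * (∑ w ∈ B, x w + ∑ w ∈ (A ∪ B)ᶜ, x w) := fun u hu => by
    rw [nbrSum, hsplit, sum_of_not_adj A u fun w hw => by simp [hA u hu w, hw],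
      sum_of_adj B u fun w hw => (hA u hu w).2 fun h => notB w h hw,
      sum_of_adj _ u fun w hw => (hA u hu w).2 (memC w hw).1, zero_add]
  have hNB : ∀ u ∈ B, x u * nbrSum G x u =
      x u * (∑ w ∈ A, x w + ∑ w ∈ (A ∪ B)ᶜ, x w) := fun u hu => by
    rw [nbrSum, hsplit, sum_of_not_adj B u fun w hw => by simp [hB u hu w, hw],
      sum_of_adj A u fun w hw => (hB u hu w).2 (notB w hw),
      sum_of_adj _ u fun w hw => (hB u hu w).2 (memC w hw).2, add_zero]
  have hNC : ∀ u ∈ (A ∪ B)ᶜ, x u * nbrSum G x u =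
      x u * (∑ w ∈ A, x w + ∑ w ∈ B, x w) + x₀ u * nbrSum G x₀ u := fun u hu => by
    have h₀ : nbrSum G x₀ u = ∑ w ∈ (A ∪ B)ᶜ, if G.Adj u w then x w else 0 := by
      rw [nbrSum, hsplit, sum_eq_zero fun w hw => by simp [x₀A w hw],
        sum_eq_zero (s := B) fun w hw => by simp [x₀B w hw], zero_add, zero_add]
      exact sum_congr rfl fun w hw => by rw [x₀C w hw]
    rw [x₀C u hu, h₀, nbrSum, hsplit,
      sum_of_adj A u fun w hw => ((hA w hw u).2 (memC u hu).1).symm,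
      sum_of_adj B u fun w hw => ((hB w hw u).2 (memC u hu).2).symm, mul_add]
  have hQ : quadForm G x₀ = ∑ u ∈ (A ∪ B)ᶜ, x₀ u * nbrSum G x₀ u := by
    rw [quadForm_eq_sum_mul_nbrSum, hsplit, sum_eq_zero fun u hu => by simp [x₀A u hu],
      sum_eq_zero (s := B) fun u hu => by simp [x₀B u hu], zero_add, zero_add]
  rw [quadForm_eq_sum_mul_nbrSum, hsplit, sum_congr rfl hNA, sum_congr rfl hNB,
    sum_congr rfl hNC, sum_add_distrib, ← sum_mul, ← sum_mul, ← sum_mul, ← hQ]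
  ring

/-! ### Balancing two classes -/

/-- Two classes of sizes `a` and `b` with `b + 2 ≤ a`, carrying the constant values `y` and `z`,
can be balanced to sizes `a - 1` and `b + 1` with a gain. -/
theorem exists_balanced_values {p a b y z : ℝ} (hp : 1 < p) (hb : 0 < b) (hab : b + 2 ≤ a)
    (hy : 0 < y) (hz : 0 < z) : ∃ y' z', 0 ≤ y' ∧ 0 ≤ z' ∧
      (a - 1) * y' + (b + 1) * z' = a * y + b * z ∧
      ((a * y) * (b * z) < ((a - 1) * y') * ((b + 1) * z') ∧
          (a - 1) * y' ^ p + (b + 1) * z' ^ p ≤ a * y ^ p + b * z ^ p ∨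
        (a * y) * (b * z) ≤ ((a - 1) * y') * ((b + 1) * z') ∧
          (a - 1) * y' ^ p + (b + 1) * z' ^ p < a * y ^ p + b * z ^ p) := by
  rcases eq_or_ne y z with rfl | hyz
  · refine ⟨y, y, hy.le, hy.le, by ring, Or.inl ⟨?_, by linarith⟩⟩
    have : 0 < y ^ 2 * (a - b - 1) := mul_pos (by positivity) (by linarith)
    linarith
  have hd : 0 < a - b := by linarith
  have ha1 : 0 < a - 1 := by linarith
  have hd1 : 0 < a - b - 1 := by linarith
  -- Exchange a fraction `τ = 1/(a - b)` of each class for the same fraction of the other: the sizes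
  -- become `a - 1` and `b + 1`, and `α, α', β, β'` are the resulting proportions. Convexity lowers
  -- the power sum, while mixing the class sums `ay, bz` raises their product by `τ(1 - τ)(ay -
  -- bz)²`.
  set α := (a - b - 1) * a / ((a - b) * (a - 1)) with hα
  set α' := b / ((a - b) * (a - 1)) with hα'
  set β := a / ((a - b) * (b + 1)) with hβ
  set β' := (a - b - 1) * b / ((a - b) * (b + 1)) with hβ'
  have ha : 0 < a := by linarith
  have pα : 0 < α := by positivity
  have pα' : 0 < α' := by positivity
  have pβ : 0 < β := by positivity
  have pβ' : 0 < β' := by positivity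
  have sα : α + α' = 1 := by rw [hα, hα']; field_simp; ring
  have sβ : β + β' = 1 := by rw [hβ, hβ']; field_simp; ring
  have h1 := (strictConvexOn_rpow hp).2 hy.le hz.le hyz pα pα' sα
  have h2 := (strictConvexOn_rpow hp).2 hy.le hz.le hyz pβ pβ' sβ
  simp only [smul_eq_mul] at h1 h2
  have eα : (a - 1) * α = (a - b - 1) * a / (a - b) := by rw [hα]; field_simp
  have eα' : (a - 1) * α' = b / (a - b) := by rw [hα']; field_simp
  have eβ : (b + 1) * β = a / (a - b) := by rw [hβ]; field_simp
  have eβ' : (b + 1) * β' = (a - b - 1) * b / (a - b) := by rw [hβ']; field_simp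
  have key : ∀ Y Z : ℝ, (a - 1) * (α * Y + α' * Z) + (b + 1) * (β * Y + β' * Z) =
      a * Y + b * Z := by
    intro Y Z
    have : (a - 1) * (α * Y + α' * Z) + (b + 1) * (β * Y + β' * Z) =
      ((a - 1) * α + (b + 1) * β) * Y + ((a - 1) * α' + (b + 1) * β') * Z := by ring
    rw [this, eα, eα', eβ, eβ']
    field_simp
    ring
  refine ⟨α * y + α' * z, β * y + β' * z, by positivity, by positivity, key y z, Or.inr ⟨?_, ?_⟩⟩
  · have e1 : (a - 1) * (α * y + α' * z) = ((a - 1) * α) * y + ((a - 1) * α') * z := by ring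
    have e2 : (b + 1) * (β * y + β' * z) = ((b + 1) * β) * y + ((b + 1) * β') * z := by ring
    rw [e1, e2, eα, eα', eβ, eβ']
    have : ((a - b - 1) * a / (a - b) * y + b / (a - b) * z) *
        (a / (a - b) * y + (a - b - 1) * b / (a - b) * z) - a * y * (b * z) =
        (a - b - 1) * ((a * y - b * z) / (a - b)) ^ 2 := by
      field_simp
      ring
    have : 0 ≤ (a - b - 1) * ((a * y - b * z) / (a - b)) ^ 2 := by positivity
    linarith
  · rw [← key (y ^ p) (z ^ p)]
    exact add_lt_add (mul_lt_mul_of_pos_left h1 ha1) (mul_lt_mul_of_pos_left h2 (by linarith))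

/-- `G` has the largest `p`-spectral radius among the `K_{r+1}`-free graphs on `V`, it is positive,
and it is attained at the nonnegative vector `x`. -/
structure IsExtremalPair (p : ℝ) (r : ℕ) (G : SimpleGraph V) (x : V → ℝ) : Prop where
  cliqueFree : G.CliqueFree (r + 1)
  nonneg : 0 ≤ x
  sum_eq : ∑ v, x v ^ p = 1
  pos : 0 < quadForm G x
  le : ∀ (H : SimpleGraph V) (y : V → ℝ), H.CliqueFree (r + 1) → 0 ≤ y → ∑ v, y v ^ p ≤ 1 →
    quadForm H y ≤ quadForm G x

/-! ### Structure of an extremal graph -/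

namespace IsExtremalPair

variable {p : ℝ} {r : ℕ} {G : SimpleGraph V} {x : V → ℝ}

/-- A nonzero `y` inside the sphere can be scaled up onto it, multiplying the form by a factor above
1. -/
theorem lt (h : IsExtremalPair p r G x) (hp : 1 < p) {H : SimpleGraph V} {y : V → ℝ}
    (hH : H.CliqueFree (r + 1)) (hy : 0 ≤ y) (hsum : ∑ v, y v ^ p < 1) :
    quadForm H y < quadForm G x := by
  rcases (quadForm_nonneg H hy).eq_or_lt with h0 | hpos
  · rw [← h0]; exact h.pos
  obtain ⟨u, -, -, hu, -⟩ := exists_adj_of_quadForm_pos hy hpos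
  set σ := ∑ v, y v ^ p with hσ
  have hσ0 : 0 < σ := sum_pos' (fun v _ => Real.rpow_nonneg (hy v) p)
    ⟨u, mem_univ _, Real.rpow_pos_of_pos hu p⟩
  have hp0 : 0 < p := by linarith
  set c := (σ⁻¹) ^ p⁻¹
  have hc1 : 1 < c := Real.one_lt_rpow ((one_lt_inv₀ hσ0).2 hsum) (by positivity)
  have hcp : c ^ p = σ⁻¹ := Real.rpow_inv_rpow (by positivity) hp0.ne'
  have := h.le H (fun v => c * y v) hH (fun v => mul_nonneg (by linarith) (hy v)) (by
    simp_rw [fun v => Real.mul_rpow (by linarith : 0 ≤ c) (hy v) (z := p)]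
    rw [← mul_sum, hcp, ← hσ, inv_mul_cancel₀ hσ0.ne'])
  rw [quadForm_smul] at this
  have hc2 : 1 < c ^ 2 := one_lt_pow₀ hc1 (by norm_num)
  nlinarith

/-- If `x_v = 0`, make `v` a clone of a vertex `u` with `x_u > 0` and a neighbour of positive
weight, and split the mass `x_u ^ p` evenly between them. For `p > 1` the total weight of the two
exceeds `x_u`, so the form grows. -/
theorem apply_pos (h : IsExtremalPair p r G x) (hp : 1 < p) (v : V) : 0 < x v := by
  classical
  by_contra hv
  have hv0 : x v = 0 := le_antisymm (not_lt.1 hv) (h.nonneg v)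
  obtain ⟨u, w, huw, hu, hw⟩ := exists_adj_of_quadForm_pos h.nonneg h.pos
  have huv : u ≠ v := by rintro rfl; exact hv hu
  have hp0 : 0 < p := by linarith
  set t := x u * (2⁻¹ : ℝ) ^ p⁻¹ with ht
  have ht0 : 0 < t := by positivity
  have htp : t ^ p = x u ^ p / 2 := by
    rw [ht, Real.mul_rpow hu.le (by positivity), Real.rpow_inv_rpow (by norm_num) hp0.ne']
    ring
  have h2t : x u < 2 * t := by
    refine (Real.rpow_lt_rpow_iff hu.le (by positivity) hp0).1 ?_
    rw [Real.mul_rpow (by norm_num) ht0.le, htp]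
    have : (2 : ℝ) ^ (1 : ℝ) < 2 ^ p := Real.rpow_lt_rpow_of_exponent_lt (by norm_num) hp
    rw [Real.rpow_one] at this
    have : 0 < x u ^ p := by positivity
    nlinarith
  set y := Function.update x u t with hy
  set z := Function.update y v t with hz
  set N := nbrSum G x u
  have hN : 0 < N := hw.trans_le (le_nbrSum h.nonneg huw)
  have hyv : y v = 0 := by simp [hy, huv.symm, hv0]
  have hyN : nbrSum G y u = N := by
    refine sum_congr rfl fun q _ => ?_
    rcases eq_or_ne q u with rfl | hq
    · simp
    · simp [hy, hq]
  have e1 : quadForm G y = quadForm G x + 2 * (t - x u) * N := quadForm_update G x u t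
  have e2 : quadForm (G.replaceVertex u v) z =
      quadForm (G.replaceVertex u v) y + 2 * (t - y v) * nbrSum (G.replaceVertex u v) y v :=
    quadForm_update _ y v t
  have e3 : quadForm G y = quadForm (G.replaceVertex u v) y := quadForm_congr_of_eq_zero hyv
    fun a b ha hb => (G.adj_replaceVertex_iff_of_ne u ha hb).symm
  have e4 : nbrSum (G.replaceVertex u v) y v = nbrSum G y u := by
    refine sum_congr rfl fun q _ => ?_
    rcases eq_or_ne q v with rfl | hq
    · simp [hyv]
    · simp [G.adj_replaceVertex_iff_of_ne_right u hq]
  have hz0 : 0 ≤ z := by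
    intro q
    simp only [hz, hy, Function.update_apply, Pi.zero_apply]
    split_ifs
    exacts [ht0.le, ht0.le, h.nonneg q]
  have hsum : ∑ q, z q ^ p = 1 := by
    rw [← h.sum_eq, ← add_sum_erase _ _ (mem_univ u),
      ← add_sum_erase _ _ (mem_erase.2 ⟨huv.symm, mem_univ v⟩),
      ← add_sum_erase univ (fun q => x q ^ p) (mem_univ u),
      ← add_sum_erase (univ.erase u) (fun q => x q ^ p) (mem_erase.2 ⟨huv.symm, mem_univ v⟩)]
    have hr : ∑ q ∈ (univ.erase u).erase v, z q ^ p = ∑ q ∈ (univ.erase u).erase v, x q ^ p := by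
      refine sum_congr rfl fun q hq => ?_
      simp only [mem_erase, mem_univ, and_true] at hq
      simp [hz, hy, hq.1, hq.2]
    have hzu : z u = t := by simp [hz, hy, huv]
    have hzv : z v = t := by simp [hz]
    rw [hr, hzu, hzv, htp, hv0, Real.zero_rpow hp0.ne']
    ring
  have := h.le _ z (h.cliqueFree.replaceVertex u v) hz0 hsum.le
  rw [e2, e4, ← e3, e1, hyN, hyv] at this
  nlinarith

theorem nbrSum_eq_of_not_adj (h : IsExtremalPair p r G x) (hp : 1 < p) {s t : V}
    (hst : ¬ G.Adj s t) : nbrSum G x s = nbrSum G x t := by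
  classical
  have key : ∀ {s t : V}, ¬ G.Adj s t → nbrSum G x s ≤ nbrSum G x t := fun {s t} hst => by
    have h1 := h.le _ x (h.cliqueFree.replaceVertex s t) h.nonneg h.sum_eq.le
    rw [quadForm_replaceVertex x hst] at h1
    have := h.apply_pos hp t
    by_contra! hlt
    nlinarith [mul_pos this (sub_pos.2 hlt)]
  exact (key hst).antisymm (key fun hts => hst hts.symm)

/-- If `t` and `u` were adjacent, turn `t` and then `u` into clones of `s`. The first step costs
nothing, as the weighted degrees agree. It takes the neighbour `t` away from `u` but leaves the
degree of `s` unchanged, so the second step gains. -/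
theorem not_adj_trans (h : IsExtremalPair p r G x) (hp : 1 < p) {t s u : V} (hts : ¬ G.Adj t s)
    (hsu : ¬ G.Adj s u) : ¬ G.Adj t u := by
  classical
  intro htu
  have hst : ¬ G.Adj s t := fun h => hts h.symm
  have nst : s ≠ t := by rintro rfl; exact hsu htu
  have nut : u ≠ t := htu.ne'
  set K := G.replaceVertex s t
  have hKsu : ¬ K.Adj s u := (G.adj_replaceVertex_iff_of_ne s nst nut).not.2 hsu
  have h1 := h.le _ x ((h.cliqueFree.replaceVertex s t).replaceVertex s u) h.nonneg h.sum_eq.le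
  rw [quadForm_replaceVertex x hKsu, quadForm_replaceVertex x hst,
    h.nbrSum_eq_of_not_adj hp hst, sub_self, mul_zero, add_zero] at h1
  have hs : nbrSum K x s = nbrSum G x s := by
    refine sum_congr rfl fun q _ => ?_
    rcases eq_or_ne q t with rfl | hq
    · simp [hst, K, G.not_adj_replaceVertex_same s q]
    · simp [K, G.adj_replaceVertex_iff_of_ne_left s hq]
  have hu : nbrSum K x u < nbrSum G x u := by
    have hKut : ¬ K.Adj u t := fun h => hsu ((G.adj_replaceVertex_iff_of_ne_right s nut).1 h.symm)
    refine sum_lt_sum (fun q _ => ?_) ⟨t, mem_univ _, ?_⟩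
    · rcases eq_or_ne q t with rfl | hq
      · simp only [hKut, if_false]
        split_ifs
        exacts [h.nonneg _, le_rfl]
      · simp [K, G.adj_replaceVertex_iff_of_ne s nut hq]
    · simp [hKut, htu.symm, h.apply_pos hp t]
  rw [hs, h.nbrSum_eq_of_not_adj hp hsu] at h1
  have := mul_pos (h.apply_pos hp u) (sub_pos.2 hu)
  linarith

theorem card_part_le (h : IsExtremalPair p r G x) (hp : 1 < p) {A B : Finset V}
    (hAB : Disjoint A B) (hB0 : B.Nonempty) (hA : ∀ u ∈ A, ∀ w, G.Adj u w ↔ w ∉ A)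
    (hB : ∀ u ∈ B, ∀ w, G.Adj u w ↔ w ∉ B) : #A ≤ #B + 1 := by
  classical
  by_contra! hlt
  have hA0 : A.Nonempty := card_pos.1 (by omega)
  obtain ⟨w, hwA⟩ := id hA0
  obtain ⟨v, hvB⟩ := id hB0
  have hwB : w ∉ B := disjoint_left.1 hAB hwA
  -- Cloning `v ∈ B` onto `w ∈ A` moves `w` from part `A` to part `B`.
  set H := G.replaceVertex v w
  set A' := A.erase w
  set B' := insert w B
  have hAB' : Disjoint A' B' := by
    rw [disjoint_left]
    intro q hq
    simp only [A', B', mem_erase, mem_insert, not_or] at hq ⊢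
    exact ⟨hq.1, disjoint_left.1 hAB hq.2⟩
  have hunion : A' ∪ B' = A ∪ B := by
    ext q
    simp only [A', B', mem_union, mem_erase, mem_insert]
    by_cases hq : q = w <;> simp [hq, hwA]
  have hA' : ∀ u ∈ A', ∀ q, H.Adj u q ↔ q ∉ A' := by
    intro u hu q
    obtain ⟨huw, huA⟩ := mem_erase.1 hu
    rcases eq_or_ne q w with rfl | hq
    · rw [H.adj_comm, G.adj_replaceVertex_iff_of_ne_right v huw, hB v hvB]
      simp [A', disjoint_left.1 hAB huA]
    · rw [G.adj_replaceVertex_iff_of_ne v huw hq, hA u huA]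
      simp [A', hq]
  have hB' : ∀ u ∈ B', ∀ q, H.Adj u q ↔ q ∉ B' := by
    intro u hu q
    rcases eq_or_ne q w with rfl | hq
    · rcases eq_or_ne u q with rfl | huq
      · simp [B']
      · have huB : u ∈ B := (mem_insert.1 hu).resolve_left huq
        rw [H.adj_comm, G.adj_replaceVertex_iff_of_ne_right v huq, hB v hvB]
        simp [B', huB]
    · rcases eq_or_ne u w with rfl | huw
      · rw [G.adj_replaceVertex_iff_of_ne_right v hq, hB v hvB]
        simp [B', hq]
      · have huB : u ∈ B := (mem_insert.1 hu).resolve_left huw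
        rw [G.adj_replaceVertex_iff_of_ne v huw hq, hB u huB]
        simp [B', hq]
  have ha : (0 : ℝ) < #A := by exact_mod_cast hA0.card_pos
  have hb : (0 : ℝ) < #B := by exact_mod_cast hB0.card_pos
  have hsA : 0 < ∑ u ∈ A, x u := sum_pos (fun u _ => h.apply_pos hp u) hA0
  have hsB : 0 < ∑ u ∈ B, x u := sum_pos (fun u _ => h.apply_pos hp u) hB0
  -- Start from the averages of `x` on `A` and `B`: averaging keeps the class sums and does not
  -- raise the power sum.
  obtain ⟨y, z, hy, hz, hsum, hgain⟩ := exists_balanced_values (a := #A) (b := #B) hp hb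
    (by exact_mod_cast hlt) (div_pos hsA ha) (div_pos hsB hb)
  have hyA := card_mul_avg_rpow_le hp.le hA0 h.nonneg
  have hzB := card_mul_avg_rpow_le hp.le hB0 h.nonneg
  rw [mul_div_cancel₀ _ ha.ne', mul_div_cancel₀ _ hb.ne'] at hsum hgain
  have hcA : (#A' : ℝ) = #A - 1 := by
    rw [card_erase_of_mem hwA, Nat.cast_sub hA0.card_pos, Nat.cast_one]
  have hcB : (#B' : ℝ) = #B + 1 := by rw [card_insert_of_notMem hwB]; push_cast; ring
  rw [← hcA, ← hcB] at hsum hgain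
  set x' : V → ℝ := fun u => if u ∈ A' then y else if u ∈ B' then z else x u with hx'
  have hx'A : ∀ u ∈ A', x' u = y := fun u hu => by simp [hx', hu]
  have hx'B : ∀ u ∈ B', x' u = z := fun u hu => by simp [hx', hu, disjoint_right.1 hAB' hu]
  have hx'C : ∀ u ∈ (A ∪ B)ᶜ, x' u = x u := fun u hu => by
    rw [← hunion, mem_compl, mem_union, not_or] at hu
    simp [hx', hu.1, hu.2]
  have hx'0 : 0 ≤ x' := by
    intro u
    simp only [hx', Pi.zero_apply]
    split_ifs
    exacts [hy, hz, h.nonneg u]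
  have hH : H.CliqueFree (r + 1) := h.cliqueFree.replaceVertex v w
  have hpow : ∑ u, x' u ^ p =
      #A' * y ^ p + #B' * z ^ p + ∑ u ∈ (A ∪ B)ᶜ, x u ^ p := by
    rw [← sum_add_sum_compl (A ∪ B), sum_congr (s₁ := (A ∪ B)ᶜ) rfl fun u hu => by rw [hx'C u hu],
      ← hunion, sum_union hAB', sum_congr rfl fun u hu => by rw [hx'A u hu],
      sum_congr (s₁ := B') rfl fun u hu => by rw [hx'B u hu]]
    simp
  have hpow0 : ∑ u ∈ A, x u ^ p + ∑ u ∈ B, x u ^ p + ∑ u ∈ (A ∪ B)ᶜ, x u ^ p = 1 := by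
    rw [← h.sum_eq, ← sum_union hAB, sum_add_sum_compl]
  have hG := quadForm_eq_of_parts x hAB hA hB
  have hH' := quadForm_eq_of_parts x' hAB' hA' hB'
  have hrest : quadForm H (fun u => if u ∈ A ∪ B then 0 else x' u) =
      quadForm G (fun u => if u ∈ A ∪ B then 0 else x u) := by
    have hvec : (fun u => if u ∈ A ∪ B then 0 else x' u) =
        fun u => if u ∈ A ∪ B then 0 else x u := by
      funext u
      split_ifs with hu
      exacts [rfl, hx'C u (mem_compl.2 hu)]
    rw [hvec]
    exact quadForm_congr_of_eq_zero (v := w) (if_pos (mem_union_left B hwA))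
      fun a b ha hb => G.adj_replaceVertex_iff_of_ne v ha hb
  rw [hunion, sum_congr rfl hx'A, sum_congr rfl hx'B, sum_congr rfl hx'C, sum_const, sum_const,
    nsmul_eq_mul, nsmul_eq_mul, hsum, hrest] at hH'
  rcases hgain with ⟨h1, h2⟩ | ⟨h1, h2⟩
  · have := h.le H x' hH hx'0 (by linarith)
    linarith
  · have := h.lt hp hH hx'0 (by linarith)
    linarith

end IsExtremalPair

/-! ### Identification with the Turán graph -/

variable {p : ℝ} {r : ℕ} {G : SimpleGraph V}

theorem IsExtremalPair.nonempty_iso_turanGraph {x : V → ℝ} (h : IsExtremalPair p r G x)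
    (hp : 1 < p) : Nonempty (G ≃g SimpleGraph.turanGraph (Fintype.card V) r) := by
  classical
  let S : Setoid V := ⟨fun u w => ¬ G.Adj u w, by simp, fun h h' => h h'.symm, h.not_adj_trans hp⟩
  let P : Finpartition (univ : Finset V) := Finpartition.ofSetoid S
  have not_adj_iff : ∀ {s t : V}, ¬ G.Adj s t ↔ P.part s = P.part t := by
    intro s t
    change S s t ↔ _
    rw [← Finpartition.mem_part_ofSetoid_iff_rel]
    change t ∈ P.part s ↔ P.part s = P.part t
    rw [P.mem_part_iff_part_eq_part (mem_univ t) (mem_univ s), eq_comm]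
  have adj_iff : ∀ A ∈ P.parts, ∀ u ∈ A, ∀ w, G.Adj u w ↔ w ∉ A := by
    intro A hA u hu w
    rw [← not_iff_not, not_adj_iff, P.part_eq_of_mem hA hu, not_not,
      eq_comm, P.part_eq_iff_mem hA]
  have equi : P.IsEquipartition := by
    by_contra hn
    rw [Finpartition.not_isEquipartition] at hn
    obtain ⟨A, hA, B, hB, hlt⟩ := hn
    have hne : A ≠ B := by rintro rfl; omega
    have := h.card_part_le hp (A := A) (B := B) (P.disjoint hA hB hne) (P.nonempty_of_mem_parts hB)
      (adj_iff A hA) (adj_iff B hB)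
    omega
  have parts_le : #P.parts ≤ r := by
    by_contra! l
    -- A transversal of the parts is a clique.
    obtain ⟨z, -, hz⟩ := P.exists_subset_part_bijOn
    have ncf : ¬ G.CliqueFree #z := by
      refine SimpleGraph.IsNClique.not_cliqueFree ⟨fun v hv w hw hn => ?_, rfl⟩
      contrapose hn
      exact hz.injOn hv hw (by rwa [← not_adj_iff])
    rw [Finset.card_eq_of_equiv hz.equiv] at ncf
    exact ncf (h.cliqueFree.mono (Nat.succ_le_of_lt l))
  have card_parts : #P.parts = min (Fintype.card V) r := by
    refine le_antisymm (le_min P.card_parts_le_card parts_le) ?_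
    by_contra! l
    rw [lt_min_iff] at l
    -- Some part contains two vertices `a`, `b`. With fewer than `r` parts `G` is `K_r`-free, so
    -- adding the edge `ab` is allowed, and it raises the form because `x > 0`.
    obtain ⟨a, -, b, -, hn, he⟩ :=
      exists_ne_map_eq_of_card_lt_of_maps_to l.1 fun a _ => P.part_mem.2 (mem_univ a)
    have cf : G.CliqueFree r := by
      intro z hz
      obtain ⟨u, hu, w, hw, huw, he⟩ := exists_ne_map_eq_of_card_lt_of_maps_to
        (hz.card_eq.symm ▸ l.2) fun a (_ : a ∈ z) => P.part_mem.2 (mem_univ a)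
      exact not_adj_iff.2 he (hz.isClique hu hw huw)
    exact (quadForm_lt_of_lt (h.apply_pos hp) (G.lt_sup_edge a b hn (not_adj_iff.2 he))).not_ge
      (h.le _ x (cf.sup_edge a b) h.nonneg h.sum_eq.le)
  obtain ⟨zm, zp⟩ := equi.exists_partPreservingEquiv
  let f : V ≃ Fin (Fintype.card V) :=
    (Equiv.subtypeUnivEquiv mem_univ).symm.trans (zm.trans (finCongr card_univ))
  have hf : ∀ a b, ¬ G.Adj a b ↔ (f a : ℕ) % #P.parts = (f b : ℕ) % #P.parts := fun a b =>
    not_adj_iff.trans (zp ⟨a, mem_univ a⟩ ⟨b, mem_univ b⟩)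
  refine ⟨f, fun {a b} => ?_⟩
  rw [SimpleGraph.turanGraph_adj, ← not_iff_not, not_ne_iff, hf, card_parts]
  -- For `n < r` the residues mod `n` and mod `r` coincide on `Fin n`.
  rcases le_or_gt r (Fintype.card V) with c | c
  · rw [min_eq_right c]
  · rw [min_eq_left c.le, Nat.mod_eq_of_lt (f a).2, Nat.mod_eq_of_lt (f b).2,
      Nat.mod_eq_of_lt ((f a).2.trans c), Nat.mod_eq_of_lt ((f b).2.trans c)]

theorem quadForm_le_pSpectralRadius [Nonempty V] (hp : 1 ≤ p) (G : SimpleGraph V) {y : V → ℝ}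
    (hy : 0 ≤ y) (hsum : ∑ v, y v ^ p ≤ 1) : quadForm G y ≤ pSpectralRadius p G := by
  have hmax := isGreatest_pSpectralRadius hp G
  have hp0 : 0 < p := by linarith
  have hle : ∀ y : V → ℝ, 0 ≤ y → ∑ v, y v ^ p = 1 → quadForm G y ≤ pSpectralRadius p G := by
    intro y hy hsum
    refine hmax.2 ⟨y, ?_, rfl⟩
    simpa only [pSphere, Set.mem_ofPred_eq, abs_of_nonneg (hy _)] using hsum
  rcases (quadForm_nonneg G hy).eq_or_lt with h0 | hpos
  -- Here `y` may be zero and cannot be rescaled; a nonnegative point of the sphere shows that the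
  -- radius is nonnegative.
  · obtain ⟨z, hz, hzr⟩ := hmax.1
    rw [← h0]
    refine (quadForm_nonneg G fun v => abs_nonneg (z v)).trans (hle _ (fun v => abs_nonneg _) hz)
  obtain ⟨u, -, -, hu, -⟩ := exists_adj_of_quadForm_pos hy hpos
  set σ := ∑ v, y v ^ p with hσ
  have hσ0 : 0 < σ := sum_pos' (fun v _ => Real.rpow_nonneg (hy v) p)
    ⟨u, mem_univ _, Real.rpow_pos_of_pos hu p⟩
  set c := (σ⁻¹) ^ p⁻¹
  have hc1 : 1 ≤ c := Real.one_le_rpow ((one_le_inv₀ hσ0).2 hsum) (by positivity)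
  have hcp : c ^ p = σ⁻¹ := Real.rpow_inv_rpow (by positivity) hp0.ne'
  have := hle (fun v => c * y v) (fun v => mul_nonneg (by linarith) (hy v)) (by
    simp_rw [fun v => Real.mul_rpow (by linarith : 0 ≤ c) (hy v) (z := p)]
    rw [← mul_sum, hcp, ← hσ, inv_mul_cancel₀ hσ0.ne'])
  rw [quadForm_smul] at this
  have hc2 : 1 ≤ c ^ 2 := one_le_pow₀ hc1
  nlinarith

theorem pSpectralRadius_pos [Nonempty V] (hp : 1 ≤ p) {a b : V} (hab : G.Adj a b) :
    0 < pSpectralRadius p G := by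
  classical
  have hp0 : 0 < p := by linarith
  have hn : (0 : ℝ) < Fintype.card V := by exact_mod_cast Fintype.card_pos
  set c : ℝ := ((Fintype.card V : ℝ)⁻¹) ^ p⁻¹
  have hc : 0 < c := by positivity
  have hcp : c ^ p = (Fintype.card V : ℝ)⁻¹ := Real.rpow_inv_rpow (by positivity) hp0.ne'
  have hle := quadForm_le_pSpectralRadius hp G (y := fun _ => c) (fun _ => hc.le)
    (by simp [hcp, hn.ne'])
  have hpos := quadForm_lt_of_lt (G := ⊥) (H := G) (x := fun _ : V => c) (fun _ => hc)
    (bot_lt_iff_ne_bot.2 (by rintro rfl; exact hab))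
  exact ((quadForm_nonneg _ fun _ => hc.le).trans_lt hpos).trans_le hle

theorem nonempty_iso_turanGraph_of_forall_le [Nontrivial V] (hp : 1 < p) (hr : 2 ≤ r)
    (hG : G.CliqueFree (r + 1)) (hmax : ∀ H : SimpleGraph V, H.CliqueFree (r + 1) →
      pSpectralRadius p H ≤ pSpectralRadius p G) :
    Nonempty (G ≃g SimpleGraph.turanGraph (Fintype.card V) r) := by
  classical
  obtain ⟨a, b, hab⟩ := exists_pair_ne V
  have hpos : 0 < pSpectralRadius p G := by
    -- A single edge is `K_3`-free, hence admissible because `r ≥ 2`.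
    have hcf : ((⊥ : SimpleGraph V) ⊔ SimpleGraph.edge a b).CliqueFree (r + 1) :=
      ((SimpleGraph.cliqueFree_bot le_rfl).sup_edge a b).mono (by omega)
    refine (pSpectralRadius_pos hp.le (a := a) (b := b) ?_).trans_le (hmax _ hcf)
    simp [SimpleGraph.edge_adj, hab]
  obtain ⟨x, hx, hxG⟩ := (isGreatest_pSpectralRadius hp.le G).1
  have habs : quadForm G (fun v => |x v|) = pSpectralRadius p G :=
    (quadForm_le_pSpectralRadius hp.le G (fun v => abs_nonneg (x v)) (le_of_eq hx)).antisymm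
      (hxG ▸ quadForm_le_abs G x)
  have h : IsExtremalPair p r G (fun v => |x v|) :=
    ⟨hG, fun v => abs_nonneg (x v), hx, habs ▸ hpos, fun H y hH hy hsum =>
      (quadForm_le_pSpectralRadius hp.le H hy hsum).trans ((hmax H hH).trans habs.ge)⟩
  exact h.nonempty_iso_turanGraph hp

end PSpectral

theorem theorem1 {V : Type*} [Fintype V] (r n : ℕ) (hr : 2 ≤ r) (p : ℝ) (hp : 1 < p)
    (G : SimpleGraph V) (hn : Fintype.card V = n) (hG : G.CliqueFree (r + 1))
    (hne : ¬ Nonempty (G ≃g SimpleGraph.turanGraph n r)) :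
    PSpectral.pSpectralRadius p G <
      PSpectral.pSpectralRadius p (SimpleGraph.turanGraph n r) := by
  subst hn
  rcases subsingleton_or_nontrivial V with hV | hV
  · have : Subsingleton (Fin (Fintype.card V)) := (Fintype.equivFin V).symm.subsingleton
    exact absurd ⟨Fintype.equivFin V, fun {a b} => iff_of_false
      (fun h => h.ne (Subsingleton.elim _ _)) fun h => h.ne (Subsingleton.elim _ _)⟩ hne
  -- The maximizer `M` is itself the Turán graph, so the Turán radius is the maximum. If `G` attains
  -- it, the same argument applies to `G`.
  obtain ⟨M, hM, hmax⟩ := Set.exists_max_image {H : SimpleGraph V | H.CliqueFree (r + 1)}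
    (PSpectral.pSpectralRadius p) (Set.toFinite _) ⟨G, hG⟩
  obtain ⟨e⟩ := PSpectral.nonempty_iso_turanGraph_of_forall_le hp hr hM hmax
  rw [← PSpectral.pSpectralRadius_eq_of_iso p e]
  refine (hmax G hG).lt_of_ne fun heq => hne ?_
  exact PSpectral.nonempty_iso_turanGraph_of_forall_le hp hr hG fun H hH =>
    (hmax H hH).trans heq.ge
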